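/- Let $R$ be a (commutative) integral domain. All algebras are commutative and unital. For a commutative ring $S$, let $\mathrm{Id}(S)$ be the Boolean algebra of idempotents of $S$, with $e\vee f=e+f-ef$, $e\wedge f=ef$ and $\neg e=1-e$. An $R$-algebra $S$ is a *Specker $R$-algebra* if there is a Boolean subalgebra $B$ of $\mathrm{Id}(S)$ that generates $S$ as an $R$-algebra and is such that, for every nonzero $e\in B$ and every $a\in R$, $ae=0$ implies $a=0$. A commutative ring is a *Baer ring* if the annihilator of each of its subsets is a principal ideal generated by an idempotent. Let $\mathbf{BSp}_R$ be the category of Specker $R$-algebras that are Baer rings, with all $R$-algebra homomorphisms; let $\mathbf{cBA}$ be the category of complete Boolean algebras with all Boolean homomorphisms; and let $\mathbf{ED}$ be the category of extremally disconnected compact Hausdorff spaces with all continuous maps. Then: 1. the categories $\mathbf{BSp}_R$ and $\mathbf{cBA}$ are equivalent; 2. the categories $\mathbf{BSp}_R$ and $\mathbf{ED}$ are dually equivalent. -/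

import Mathlib

open CategoryTheory

universe u v

/-- The set `Id(S)` of idempotents of a commutative ring `S`. Mathlib makes it a Boolean algebra
with `e ⊔ f = e + f - e * f`, `e ⊓ f = e * f`, `eᶜ = 1 - e`. -/
abbrev Idem (S : Type*) [CommRing S] : Type _ := {e : S // IsIdempotentElem e}

/-- An idempotent `e` of an `R`-algebra is faithful if it is nonzero and `a • e = 0` with `a : R`
forces `a = 0`. -/
def IsFaithfulIdem (R : Type*) {S : Type*} [CommRing R] [CommRing S] [Algebra R S]
    (e : Idem S) : Prop :=
  e.1 ≠ 0 ∧ ∀ a : R, a • e.1 = 0 → a = 0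

/-- A Boolean subalgebra `B` of `Id(S)` is a faithful generating algebra of idempotents of the
`R`-algebra `S` if it generates `S` as an `R`-algebra and all its nonzero elements are faithful. -/
def IsFaithfulGenerating (R : Type*) {S : Type*} [CommRing R] [CommRing S] [Algebra R S]
    (B : BooleanSubalgebra (Idem S)) : Prop :=
  Algebra.adjoin R {s : S | ∃ e ∈ B, e.1 = s} = ⊤ ∧ ∀ e ∈ B, e.1 ≠ 0 → IsFaithfulIdem R e

/-- A commutative `R`-algebra is a Specker `R`-algebra if it has a faithful generating algebra of
idempotents. -/
def IsSpecker (R S : Type*) [CommRing R] [CommRing S] [Algebra R S] : Prop :=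
  ∃ B : BooleanSubalgebra (Idem S), IsFaithfulGenerating R B

/-- A commutative ring is a Baer ring if the annihilator ideal of each of its subsets is a principal
ideal generated by an idempotent. -/
def IsBaerRing (S : Type*) [CommRing S] : Prop :=
  ∀ T : Set S, ∃ e : S, IsIdempotentElem e ∧
    ∀ x : S, (∀ t ∈ T, x * t = 0) ↔ x ∈ Ideal.span {e}

/-- The category of Baer Specker `R`-algebras: objects are the commutative `R`-algebras that are
Specker `R`-algebras and Baer rings, morphisms are all `R`-algebra homomorphisms. -/
abbrev BSp (R : Type u) [CommRing R] :=
  ObjectProperty.FullSubcategory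
    (fun S : CommAlgCat.{v} R => IsSpecker R S ∧ IsBaerRing S)

/-- The category of complete Boolean algebras, as a full subcategory of the category of Boolean
algebras: the morphisms are all Boolean homomorphisms, not only those preserving
infinite joins. -/
abbrev CBA :=
  ObjectProperty.FullSubcategory
    (fun B : BoolAlg.{v} => ∀ s : Set B, ∃ b : B, IsLUB s b)

/-!
Both equivalences pass through two functors into complete Boolean algebras, each shown to be fully
faithful and essentially surjective.

* `idemFunctor` sends a Baer Specker `R`-algebra `S` to `Id(S)`, which is complete because the
  generator of the annihilator of a set of idempotents is the complement of their join.
  An element of an algebra generated by a Boolean algebra of idempotents is a scalar on each block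
  of some finite partition of unity; `locally_scalar_induction` is this fact in the form of an
  induction principle. It shows that a Specker algebra over a domain is torsion-free, so that *all*
  its nonzero idempotents are faithful, and that the subalgebra of `S × T` generated by the graph
  of a Boolean homomorphism `φ : Id(S) → Id(T)` is itself the graph of an algebra homomorphism
  (`exists_algHom_extending`), which gives fullness. Faithfulness is immediate, since idempotents
  generate. For essential surjectivity, a complete Boolean algebra is the algebra of clopens of an
  extremally disconnected compact Hausdorff space `X`, and the locally constant functions `X → R`
  form a Baer Specker algebra with idempotents the indicators of clopens.
* `clopensFunctor` sends an extremally disconnected compact Hausdorff space to its clopens. This is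
  Stone duality: a Boolean homomorphism `Clopens Y → Clopens X` pulls each point of `X` back to an
  ultrafilter of clopens, which by compactness has exactly one point in common. The space attached
  to a complete Boolean algebra is the prime spectrum of the corresponding Boolean ring, and
  completeness forces it to be extremally disconnected.
-/

open TopologicalSpace (Clopens)

/-! ### Elements of algebras generated by idempotents -/

/-- Let `ψ` be a representation of a Boolean algebra `L` by idempotents of an algebra `A`. To prove
a property `P` of `c : L` that is stable under joins, it suffices to prove it for those `d ≤ c` on
which a given element `x` of the algebra generated by `ψ` is scalar: there are finitely many such
`d` with join `c`. -/
theorem locally_scalar_induction {R A L : Type*} [CommRing R] [CommRing A] [Algebra R A]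
    [BooleanAlgebra L] (ψ : L → A) (hinf : ∀ a b, ψ (a ⊓ b) = ψ a * ψ b)
    (hcompl : ∀ a, ψ aᶜ = 1 - ψ a) {x : A} (hx : x ∈ Algebra.adjoin R (Set.range ψ))
    (P : L → Prop) (hsup : ∀ a b, P a → P b → P (a ⊔ b)) (c : L)
    (hP : ∀ d ≤ c, ∀ r : R, ψ d * x = r • ψ d → P d) : P c := by
  induction hx using Algebra.adjoin_induction generalizing c with
  | mem x hx =>
    obtain ⟨e, rfl⟩ := hx
    have he : ψ e * ψ e = ψ e := by rw [← hinf, inf_idem]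
    rw [← sup_inf_inf_compl (x := c) (y := e)]
    refine hsup _ _ (hP _ inf_le_left 1 ?_) (hP _ inf_le_left 0 ?_)
    · rw [hinf, mul_assoc, he, one_smul]
    · rw [hinf, hcompl, mul_assoc, sub_mul, he]; simp
  | algebraMap r =>
    exact hP c le_rfl r (by rw [Algebra.smul_def, mul_comm])
  | add x y _ _ ihx ihy =>
    refine ihx c fun d hd r hr => ihy d fun d' hd' r' hr' => hP d' (hd'.trans hd) (r + r') ?_
    have h : ψ d' = ψ d' * ψ d := by rw [← hinf, inf_eq_left.2 hd']
    rw [mul_add, hr', add_smul, h, mul_assoc, hr, mul_smul_comm]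
  | mul x y _ _ ihx ihy =>
    refine ihx c fun d hd r hr => ihy d fun d' hd' r' hr' => hP d' (hd'.trans hd) (r * r') ?_
    have h : ψ d' = ψ d' * ψ d := by rw [← hinf, inf_eq_left.2 hd']
    have h1 : ψ d' * x = r • ψ d' := by rw [h, mul_assoc, hr, mul_smul_comm]
    rw [← mul_assoc, h1, smul_mul_assoc, hr', smul_smul]

/-! ### Specker algebras -/

section Specker

variable {R S T : Type*} [CommRing R] [CommRing S] [Algebra R S] [CommRing T] [Algebra R T]

theorem Idem.coe_sup (e f : Idem S) : (e ⊔ f).1 = e.1 + f.1 - e.1 * f.1 := rfl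

theorem Idem.coe_inf (e f : Idem S) : (e ⊓ f).1 = e.1 * f.1 := rfl

theorem Idem.coe_compl (e : Idem S) : (eᶜ).1 = 1 - e.1 := rfl

theorem Idem.le_iff {e f : Idem S} : e ≤ f ↔ e.1 * f.1 = e.1 := Iff.rfl

/-- The Boolean homomorphism on idempotents induced by an algebra homomorphism. -/
def Idem.map (f : S →ₐ[R] T) : BoundedLatticeHom (Idem S) (Idem T) where
  toFun e := ⟨f e.1, e.2.map f⟩
  map_sup' a b := Subtype.ext (by simp [Idem.coe_sup])
  map_inf' a b := Subtype.ext (by simp [Idem.coe_inf])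
  map_top' := Subtype.ext (map_one f)
  map_bot' := Subtype.ext (map_zero f)

/-- A Specker algebra over a domain is torsion-free. -/
theorem IsSpecker.eq_zero_of_smul_eq_zero [IsDomain R] (hS : IsSpecker R S) {a : R} (ha : a ≠ 0)
    {s : S} (h : a • s = 0) : s = 0 := by
  obtain ⟨B, hgen, hfaith⟩ := hS
  have hs : s ∈ Algebra.adjoin R (Set.range fun e : B => e.1.1) := by
    have : Set.range (fun e : B => e.1.1) = {s : S | ∃ e ∈ B, e.1 = s} := by
      ext; simp
    rw [this, hgen]; trivial
  have key := locally_scalar_induction (fun e : B => e.1.1) (fun _ _ => rfl) (fun _ => rfl) hs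
    (fun d => d.1.1 * s = 0) ?_ ⊤ ?_
  · exact (one_mul s).symm.trans key
  · intro d d' hd hd'
    change (d.1.1 + d'.1.1 - d.1.1 * d'.1.1) * s = 0
    rw [sub_mul, add_mul, mul_assoc, hd, hd']; simp
  · intro d _ r hr
    by_cases hd : d.1.1 = 0
    · rw [hd, zero_mul]
    · have h0 : (a * r) • d.1.1 = 0 := by
        rw [mul_smul, ← hr, ← mul_smul_comm, h, mul_zero]
      have : r = 0 := (mul_eq_zero.1 ((hfaith d.1 d.2 hd).2 _ h0)).resolve_left ha
      exact hr.trans (by rw [this, zero_smul])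

theorem IsSpecker.adjoin_range_idem (hS : IsSpecker R S) :
    Algebra.adjoin R (Set.range fun e : Idem S => e.1) = ⊤ := by
  obtain ⟨B, hgen, -⟩ := hS
  refine top_le_iff.1 (hgen.ge.trans (Algebra.adjoin_mono ?_))
  rintro _ ⟨e, -, rfl⟩
  exact ⟨e, rfl⟩

theorem IsSpecker.algHom_ext (hS : IsSpecker R S) {f g : S →ₐ[R] T}
    (h : ∀ e : Idem S, f e.1 = g e.1) : f = g := by
  refine AlgHom.ext_of_adjoin_eq_top hS.adjoin_range_idem ?_
  rintro _ ⟨e, rfl⟩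
  exact h e

/-- Boolean homomorphisms between algebras of idempotents extend to algebra homomorphisms out of a
Specker algebra. -/
theorem IsSpecker.exists_algHom_extending [IsDomain R] (hS : IsSpecker R S)
    (φ : BoundedLatticeHom (Idem S) (Idem T)) :
    ∃ f : S →ₐ[R] T, ∀ e : Idem S, f e.1 = (φ e).1 := by
  let ψ : Idem S → S × T := fun e => (e.1, (φ e).1)
  let G := Algebra.adjoin R (Set.range ψ)
  let p : G →ₐ[R] S := (AlgHom.fst R S T).comp G.val
  have hp : Function.Bijective p := by
    constructor
    · rw [injective_iff_map_eq_zero]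
      rintro ⟨⟨s, t⟩, hx⟩ hs
      obtain rfl : s = 0 := hs
      suffices t = 0 by subst this; rfl
      have key := locally_scalar_induction ψ (fun a b => ?_) (fun a => ?_) hx
        (fun d => (φ d).1 * t = 0) ?_ ⊤ ?_
      · rw [map_top] at key
        exact (one_mul t).symm.trans key
      · exact Prod.ext rfl (by simp only [ψ, map_inf]; rfl)
      · exact Prod.ext rfl (by simp only [ψ, map_compl']; rfl)
      · intro d d' hd hd'
        rw [map_sup, Idem.coe_sup, sub_mul, add_mul, mul_assoc, hd, hd']; simp
      · intro d _ r hr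
        have h1 : d.1 * 0 = r • d.1 := congrArg Prod.fst hr
        have h2 : (φ d).1 * t = r • (φ d).1 := congrArg Prod.snd hr
        rw [mul_zero] at h1
        by_cases hr0 : r = 0
        · rw [h2, hr0, zero_smul]
        · have hd : d = ⊥ := Subtype.ext (hS.eq_zero_of_smul_eq_zero hr0 h1.symm)
          rw [hd, map_bot]
          exact zero_mul t
    · rw [← AlgHom.range_eq_top, ← top_le_iff, ← hS.adjoin_range_idem, Algebra.adjoin_le_iff]
      rintro _ ⟨e, rfl⟩
      exact ⟨⟨ψ e, Algebra.subset_adjoin ⟨e, rfl⟩⟩, rfl⟩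
  refine ⟨((AlgHom.snd R S T).comp G.val).comp (AlgEquiv.ofBijective p hp).symm.toAlgHom,
    fun e => ?_⟩
  have : (AlgEquiv.ofBijective p hp).symm e.1 = ⟨ψ e, Algebra.subset_adjoin ⟨e, rfl⟩⟩ := by
    rw [AlgEquiv.symm_apply_eq]; rfl
  change ((AlgEquiv.ofBijective p hp).symm e.1).1.2 = _
  rw [this]

/-- The complement of the idempotent generating the annihilator of a set of idempotents is their
join. -/
theorem IsBaerRing.exists_isLUB (hS : IsBaerRing S) (s : Set (Idem S)) :
    ∃ b : Idem S, IsLUB s b := by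
  obtain ⟨e, he, h⟩ := hS (Subtype.val '' s)
  have hspan (x : S) : x ∈ Ideal.span {e} ↔ x * e = x := by
    rw [Ideal.mem_span_singleton']
    exact ⟨by rintro ⟨y, rfl⟩; rw [mul_assoc, he.eq], fun hx => ⟨x, hx⟩⟩
  have hub (f : Idem S) : f ∈ upperBounds s ↔ (⟨e, he⟩ : Idem S)ᶜ ≤ f := by
    rw [← compl_le_compl_iff_le, compl_compl, Idem.le_iff]
    change _ ↔ (fᶜ).1 * e = (fᶜ).1
    rw [← hspan, ← h, Set.forall_mem_image]
    refine forall₂_congr fun t _ => ?_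
    rw [Idem.le_iff, Idem.coe_compl, sub_mul, one_mul, sub_eq_zero, mul_comm, eq_comm]
  exact ⟨_, (hub _).2 le_rfl, fun f hf => (hub f).1 hf⟩

end Specker

/-! ### Algebras of locally constant functions -/

section LocallyConstant

variable (R X : Type*) [CommRing R] [IsDomain R] [TopologicalSpace X]

/-- Over a domain, the idempotent locally constant functions are the indicators of clopens. -/
noncomputable def clopensEquivIdem : Clopens X ≃o Idem (LocallyConstant X R) where
  toFun U := ⟨LocallyConstant.charFn R U.isClopen, by
    ext x
    by_cases hx : x ∈ (U : Set X) <;> simp [LocallyConstant.coe_charFn, hx]⟩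
  invFun e := ⟨{x | e.1 x = 1}, e.1.isLocallyConstant.isClopen_fiber 1⟩
  left_inv U := Clopens.ext (Set.ext fun x => LocallyConstant.charFn_eq_one R x U.isClopen)
  right_inv e := by
    refine Subtype.ext (LocallyConstant.ext fun x => ?_)
    have hU := e.1.isLocallyConstant.isClopen_fiber 1
    have hx : e.1 x * e.1 x = e.1 x := LocallyConstant.congr_fun e.2 x
    by_cases h : e.1 x = 1
    · exact ((LocallyConstant.charFn_eq_one R x hU).2 h).trans h.symm
    · have h0 : e.1 x = 0 := by
        by_contra h0
        exact h (mul_left_cancel₀ h0 (hx.trans (mul_one _).symm))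
      exact ((LocallyConstant.charFn_eq_zero R x hU).2 h).trans h0.symm
  map_rel_iff' {U V} := by
    rw [Idem.le_iff]
    constructor
    · intro h x hx
      have h1 := LocallyConstant.congr_fun h x
      change LocallyConstant.charFn R U.isClopen x * LocallyConstant.charFn R V.isClopen x =
        LocallyConstant.charFn R U.isClopen x at h1
      rw [(LocallyConstant.charFn_eq_one R x U.isClopen).2 hx, one_mul] at h1
      exact (LocallyConstant.charFn_eq_one R x V.isClopen).1 h1
    · intro h
      ext x
      by_cases hx : x ∈ (U : Set X)
      · have hV : x ∈ (V : Set X) := h hx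
        simp [LocallyConstant.coe_charFn, hx, hV]
      · simp [LocallyConstant.coe_charFn, hx]

theorem isSpecker_locallyConstant [CompactSpace X] : IsSpecker R (LocallyConstant X R) := by
  refine ⟨⊤, ?_, fun e _ he => ⟨he, fun a ha => ?_⟩⟩
  · refine top_le_iff.1 fun f _ => ?_
    have hf : f = ∑ r ∈ f.range_finite.toFinset,
        r • LocallyConstant.charFn R (f.isLocallyConstant.isClopen_fiber r) := by
      ext x
      rw [← LocallyConstant.evalₐ_apply R x (∑ r ∈ _, _), map_sum,
        Finset.sum_eq_single (f x)]
      · simp [LocallyConstant.coe_charFn]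
      · intro r _ hr
        simp [LocallyConstant.coe_charFn, hr.symm]
      · simp
    rw [hf]
    refine Subalgebra.sum_mem _ fun r _ => Subalgebra.smul_mem _ (Algebra.subset_adjoin ?_) r
    exact ⟨clopensEquivIdem R X ⟨_, f.isLocallyConstant.isClopen_fiber r⟩, trivial, rfl⟩
  · obtain ⟨x, hx⟩ : ∃ x, e.1 x ≠ 0 := by
      by_contra! h
      exact he (LocallyConstant.ext h)
    exact (mul_eq_zero.1 (LocallyConstant.congr_fun ha x)).resolve_right hx

/-- The annihilator of `T` consists of the functions vanishing on the closure of the union of the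
supports of the elements of `T`, which is clopen. -/
theorem isBaerRing_locallyConstant [ExtremallyDisconnected X] :
    IsBaerRing (LocallyConstant X R) := by
  intro T
  let U : Set X := ⋃ t ∈ T, {x | t x ≠ 0}
  have hU : IsOpen U :=
    isOpen_biUnion fun t _ => (t.isLocallyConstant.isClosed_fiber 0).isOpen_compl
  have hC : IsClopen (closure U)ᶜ :=
    IsClopen.compl ⟨isClosed_closure, ExtremallyDisconnected.open_closure U hU⟩
  refine ⟨_, (clopensEquivIdem R X ⟨_, hC⟩).2, fun f => ?_⟩
  change _ ↔ f ∈ Ideal.span {LocallyConstant.charFn R hC}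
  rw [Ideal.mem_span_singleton']
  constructor
  · intro h
    refine ⟨f, LocallyConstant.ext fun x => ?_⟩
    by_cases hx : x ∈ closure U
    · have hsub : U ⊆ {x | f x = 0} := by
        intro y hy
        simp only [U, Set.mem_iUnion] at hy
        obtain ⟨t, ht, hty⟩ := hy
        exact (mul_eq_zero.1 (LocallyConstant.congr_fun (h t ht) y)).resolve_right hty
      have hfx : f x = 0 := closure_minimal hsub (f.isLocallyConstant.isClosed_fiber 0) hx
      simp [hfx]
    · simp [LocallyConstant.coe_charFn, hx]
  · rintro ⟨g, rfl⟩ t ht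
    ext x
    by_cases hx : t x = 0
    · simp [hx]
    · have : x ∈ closure U := subset_closure (Set.mem_biUnion ht hx)
      simp [LocallyConstant.coe_charFn, this]

end LocallyConstant

/-! ### Stone duality for extremally disconnected spaces -/

section Stone

variable {X Y : Type*} [TopologicalSpace X] [TopologicalSpace Y]

theorem Clopens.exists_isLUB [ExtremallyDisconnected X] (s : Set (Clopens X)) :
    ∃ b, IsLUB s b := by
  have hU : IsOpen (⋃ V ∈ s, (V : Set X)) := isOpen_biUnion fun V _ => V.isOpen
  refine ⟨⟨_, isClosed_closure, ExtremallyDisconnected.open_closure _ hU⟩, fun V hV => ?_,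
    fun W hW => ?_⟩
  · exact (Set.subset_biUnion_of_mem hV).trans subset_closure
  · exact closure_minimal (Set.iUnion₂_subset fun V hV => hW hV) W.isClosed

theorem extremallyDisconnected_of_exists_isLUB [CompactSpace X] [T2Space X]
    [TotallyDisconnectedSpace X] (h : ∀ s : Set (Clopens X), ∃ b, IsLUB s b) :
    ExtremallyDisconnected X := by
  refine ⟨fun U hU => ?_⟩
  obtain ⟨W, hW⟩ := h {V | (V : Set X) ⊆ U}
  suffices closure U = W by rw [this]; exact W.isOpen
  refine (closure_minimal (fun x hx => ?_) W.isClosed).antisymm ?_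
  · obtain ⟨V, hV, hxV, hVU⟩ := compact_exists_isClopen_in_isOpen hU hx
    exact (hW.1 (show (⟨V, hV⟩ : Clopens X) ∈ _ from hVU)) hxV
  · by_contra hne
    obtain ⟨x, hxW, hxU⟩ := Set.not_subset.1 hne
    -- A clopen neighbourhood of `x` in `W \ closure U` can be removed from the least upper bound.
    obtain ⟨V, hV, hxV, hVU⟩ :=
      compact_exists_isClopen_in_isOpen isClosed_closure.isOpen_compl hxU
    have hle : W ≤ W \ ⟨V, hV⟩ := hW.2 fun V' hV' y hy =>
      ⟨hW.1 hV' hy, fun hyV => hVU hyV (subset_closure (hV' hy))⟩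
    exact (hle hxW).2 hxV

/-- The Boolean homomorphism on clopens given by preimages along a continuous map. -/
def Clopens.preimage (f : C(X, Y)) : BoundedLatticeHom (Clopens Y) (Clopens X) where
  toFun U := ⟨f ⁻¹' U, U.isClopen.preimage f.continuous⟩
  map_sup' _ _ := rfl
  map_inf' _ _ := rfl
  map_top' := rfl
  map_bot' := rfl

theorem Clopens.preimage_injective [CompactSpace Y] [T2Space Y] [TotallyDisconnectedSpace Y] :
    Function.Injective (Clopens.preimage : C(X, Y) → _) := by
  intro f g h
  ext x
  by_contra hne
  obtain ⟨U, hU, hf, hg⟩ := exists_isClopen_of_totally_separated hne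
  have h1 : Clopens.preimage f ⟨U, hU⟩ = Clopens.preimage g ⟨U, hU⟩ := by rw [h]
  have h2 : x ∈ Clopens.preimage g ⟨U, hU⟩ := h1 ▸ (show x ∈ Clopens.preimage f ⟨U, hU⟩ from hf)
  exact hg h2

theorem Clopens.preimage_surjective [CompactSpace Y] [T2Space Y] [TotallyDisconnectedSpace Y] :
    Function.Surjective (Clopens.preimage : C(X, Y) → _) := by
  intro φ
  -- The clopens `U` with `x ∈ φ U` form an ultrafilter; compactness gives it a limit.
  have hex (x : X) : ∃ y : Y, ∀ U : Clopens Y, x ∈ φ U → y ∈ U := by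
    have := CompactSpace.iInter_nonempty (X := Y) (ι := {U : Clopens Y // x ∈ φ U})
      (t := fun U => (U.1 : Set Y)) (fun U => U.1.isClosed) fun s => by
        have hs : x ∈ φ (s.inf Subtype.val) := by
          rw [map_finset_inf]
          refine Finset.inf_induction (p := fun V => x ∈ V) (Set.mem_univ x)
            (fun _ h₁ _ h₂ => ⟨h₁, h₂⟩) fun U _ => U.2
        by_contra hempty
        rw [Set.not_nonempty_iff_eq_empty] at hempty
        have hbot : s.inf Subtype.val = (⊥ : Clopens Y) := by
          refine le_bot_iff.1 fun y hy => ?_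
          exact hempty.le (Set.mem_iInter₂.2 fun U hU => (Finset.inf_le hU : _ ≤ U.1) hy)
        rw [hbot, map_bot] at hs
        exact hs
    obtain ⟨y, hy⟩ := this
    exact ⟨y, fun U hU => Set.mem_iInter.1 hy ⟨U, hU⟩⟩
  choose f hf using hex
  have hiff (x : X) (U : Clopens Y) : f x ∈ U ↔ x ∈ φ U := by
    refine ⟨fun h => ?_, hf x U⟩
    by_contra hx
    refine hf x Uᶜ ?_ h
    rw [map_compl']
    exact hx
  have hcont : Continuous f := by
    refine isTopologicalBasis_isClopen.continuous_iff.2 fun U hU => ?_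
    have : f ⁻¹' U = φ ⟨U, hU⟩ := Set.ext fun x => hiff x ⟨U, hU⟩
    rw [this]
    exact (φ _).isOpen
  exact ⟨⟨f, hcont⟩, BoundedLatticeHom.ext fun U => Clopens.ext (Set.ext fun x => hiff x U)⟩

end Stone

/-! ### The spectrum of a Boolean algebra -/

section Spectrum

variable (B : Type*) [BooleanAlgebra B]

/-- Every element of a Boolean ring is idempotent. -/
def orderIsoIdemAsBoolRing : B ≃o Idem (AsBoolRing B) where
  toFun b := ⟨toBoolRing b, BooleanRing.mul_self _⟩
  invFun e := ofBoolRing e.1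
  left_inv _ := rfl
  right_inv _ := rfl
  map_rel_iff' {a b} := (ofBoolRing_le_ofBoolRing_iff (a := toBoolRing a) (b := toBoolRing b)).symm

/-- Stone's representation: a Boolean algebra is the algebra of clopens of the prime spectrum of its
Boolean ring. -/
noncomputable def orderIsoClopensSpectrum : B ≃o Clopens (PrimeSpectrum (AsBoolRing B)) :=
  (orderIsoIdemAsBoolRing B).trans PrimeSpectrum.isIdempotentElemEquivClopens

instance : TotallySeparatedSpace (PrimeSpectrum (AsBoolRing B)) := by
  refine totallySeparatedSpace_iff_exists_isClopen.2 fun p q hpq => ?_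
  have hclopen (f : AsBoolRing B) :
      IsClopen (PrimeSpectrum.basicOpen f : Set (PrimeSpectrum (AsBoolRing B))) :=
    PrimeSpectrum.isClopen_iff.2 ⟨f, BooleanRing.mul_self f, rfl⟩
  by_cases hle : p.asIdeal ≤ q.asIdeal
  · obtain ⟨f, hfq, hfp⟩ := Set.not_subset.1 fun h : q.asIdeal ≤ p.asIdeal =>
      hpq (PrimeSpectrum.ext (hle.antisymm h))
    exact ⟨_, hclopen f, hfp, fun h => h hfq⟩
  · obtain ⟨f, hfp, hfq⟩ := Set.not_subset.1 hle
    exact ⟨_, (hclopen f).compl, fun h => h hfp, fun h => h hfq⟩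

theorem extremallyDisconnected_spectrum (h : ∀ s : Set B, ∃ b, IsLUB s b) :
    ExtremallyDisconnected (PrimeSpectrum (AsBoolRing B)) := by
  refine extremallyDisconnected_of_exists_isLUB fun s => ?_
  let e := orderIsoClopensSpectrum B
  obtain ⟨b, hb⟩ := h (e.symm '' s)
  exact ⟨e b, by simpa using (e.isLUB_image' (s := e.symm '' s)).2 hb⟩

end Spectrum

/-! ### The equivalences -/

/-- The functor of clopen subsets on extremally disconnected compact Hausdorff spaces. -/
def clopensFunctor : Stonean.{v}ᵒᵖ ⥤ CBA.{v} where
  obj X := ⟨BoolAlg.of (Clopens X.unop), Clopens.exists_isLUB⟩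
  map f := ObjectProperty.homMk (BoolAlg.ofHom (Clopens.preimage f.unop.hom.hom))

instance : clopensFunctor.{v}.Faithful where
  map_injective {X Y f g} h := by
    have h1 : Clopens.preimage f.unop.hom.hom = Clopens.preimage g.unop.hom.hom :=
      congrArg (fun k => k.hom.hom) h
    have h2 := Clopens.preimage_injective h1
    apply Quiver.Hom.unop_inj
    ext x
    exact DFunLike.congr_fun h2 x

instance : clopensFunctor.{v}.Full where
  map_surjective {X Y} φ := by
    obtain ⟨f, hf⟩ := Clopens.preimage_surjective (X := Y.unop) (Y := X.unop) φ.hom.hom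
    refine ⟨Quiver.Hom.op (CompHausLike.ofHom _ f), ?_⟩
    apply ObjectProperty.hom_ext
    apply BoolAlg.hom_ext
    exact hf

instance : clopensFunctor.{v}.EssSurj where
  mem_essImage B := by
    have := extremallyDisconnected_spectrum B.obj B.property
    exact ⟨Opposite.op (Stonean.of (PrimeSpectrum (AsBoolRing B.obj))),
      ⟨ObjectProperty.isoMk _ (BoolAlg.Iso.mk (orderIsoClopensSpectrum B.obj).symm)⟩⟩

instance : clopensFunctor.{v}.IsEquivalence where

/-- The functor of idempotents on Baer Specker algebras. -/
def idemFunctor (R : Type u) [CommRing R] : BSp.{u, v} R ⥤ CBA.{v} where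
  obj S := ⟨BoolAlg.of (Idem S.obj), S.property.2.exists_isLUB⟩
  map f := ObjectProperty.homMk (BoolAlg.ofHom (Idem.map f.hom.hom))

instance (R : Type u) [CommRing R] : (idemFunctor.{u, v} R).Faithful where
  map_injective {S T f g} h := by
    have h1 : Idem.map f.hom.hom = Idem.map g.hom.hom := congrArg (fun k => k.hom.hom) h
    apply ObjectProperty.hom_ext
    apply CommAlgCat.hom_ext
    exact S.property.1.algHom_ext fun e => congrArg Subtype.val (DFunLike.congr_fun h1 e)

instance (R : Type u) [CommRing R] [IsDomain R] : (idemFunctor.{u, v} R).Full where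
  map_surjective {S T} φ := by
    obtain ⟨f, hf⟩ := S.property.1.exists_algHom_extending (T := T.obj) φ.hom.hom
    refine ⟨ObjectProperty.homMk (CommAlgCat.ofHom f), ?_⟩
    apply ObjectProperty.hom_ext
    apply BoolAlg.hom_ext
    exact BoundedLatticeHom.ext fun e => Subtype.ext (hf e)

instance (R : Type u) [CommRing R] [IsDomain R] : (idemFunctor.{u, max u v} R).EssSurj where
  mem_essImage B := by
    have := extremallyDisconnected_spectrum B.obj B.property
    let X := PrimeSpectrum (AsBoolRing B.obj)
    exact ⟨⟨CommAlgCat.of R (LocallyConstant X R), isSpecker_locallyConstant R X,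
      isBaerRing_locallyConstant R X⟩, ⟨ObjectProperty.isoMk _ (BoolAlg.Iso.mk
        ((orderIsoClopensSpectrum B.obj).trans (clopensEquivIdem R X)).symm)⟩⟩

instance (R : Type u) [CommRing R] [IsDomain R] : (idemFunctor.{u, max u v} R).IsEquivalence where

theorem theorem4p7 (R : Type u) [CommRing R] [IsDomain R] :
    Nonempty (BSp.{u, max u v} R ≌ CBA.{max u v}) ∧
      Nonempty ((BSp.{u, max u v} R)ᵒᵖ ≌ Stonean.{max u v}) := by
  let e : BSp.{u, max u v} R ≌ CBA.{max u v} := (idemFunctor.{u, max u v} R).asEquivalence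
  exact ⟨⟨e⟩, ⟨(e.trans clopensFunctor.{max u v}.asEquivalence.symm).op.trans
    (opOpEquivalence _)⟩⟩
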